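/- Let $n\ge 1$, let $\Omega,\Lambda\subset\mathbb{R}^n$ be bounded open sets with $\Lambda$ convex, and let $f\in C^0(\overline\Omega)$ and $g\in C^0(\overline\Lambda)$ be positive and bounded away from zero and infinity on $\Omega$ and $\Lambda$, respectively, with $\int_\Omega f\,dx=\int_\Lambda g\,dx$. Call a function on $\Omega$ convex if it is the restriction to $\Omega$ of a convex function on the convex hull of $\Omega$. Let $\varphi\in C^2(\Omega)$ be a Brenier potential from $f\,dx$ on $\Omega$ to $g\,dx$ on $\Lambda$, that is, a convex function such that $\nabla\varphi$ pushes $f\,dx|_\Omega$ forward to $g\,dx|_\Lambda$. (For Hölder continuous $f$ and $g$ such a $\varphi$ exists by theorems of Brenier and Caffarelli.) Put $$\mathcal J:=\{\psi\in C^2(\Omega):\ \psi\text{ convex and }\nabla\psi(\Omega)\subseteq\Lambda\},$$ $$\mathcal G_1(\psi,x):=\max\{0,\,-\log\det\nabla^2\psi(x)-\log g(\nabla\psi(x))+\log f(x)\},$$ $$\mathcal G_2(\psi,x):=\max\Big\{0,\,-\big(\det\nabla^2\psi(x)\big)^{1/n}+\big(f(x)/g(\nabla\psi(x))\big)^{1/n}\Big\},$$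 where $\mathcal G_1(\psi,x)=+\infty$ if $\det\nabla^2\psi(x)=0$. Then $\varphi\in\mathcal J$, and $\varphi$ is, up to an additive constant, the unique minimizer over $\psi\in\mathcal J$ of each of the following functionals with values in $[0,\infty]$: 1. $\int_\Omega\mathcal G_1(\psi,x)\,dx$; 2. $\int_\Omega\mathcal G_2(\psi,x)\,dx$; 3. $\int_\Omega h(\mathcal G_1(\psi,x))\,\rho(x)\,dx$, for every convex, strictly increasing $h:[0,\infty)\to\mathbb{R}$ with $h(0)=0$ (extended by $h(+\infty)=+\infty$) and every measurable $\rho:\Omega\to(0,\infty)$ bounded away from zero and infinity. That is, $\varphi$ attains the minimum over $\mathcal J$, and for every minimizer $\psi\in\mathcal J$ there is a constant $c\in\mathbb{R}$ with $\psi=\varphi+c$ on $\Omega$. -/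

import Mathlib

open MeasureTheory Set
open scoped ENNReal Gradient

noncomputable section

namespace MongeAmpere

/-- A function `ψ` is convex on a (not necessarily convex, not necessarily connected) set `Ω`
if it is the restriction to `Ω` of a convex function on the convex hull of `Ω`.
For convex `Ω` this is `ConvexOn ℝ Ω ψ`. -/
def ConvexFunctionOn {n : ℕ} (Ω : Set (EuclideanSpace ℝ (Fin n)))
    (ψ : EuclideanSpace ℝ (Fin n) → ℝ) : Prop :=
  ∃ Ψ : EuclideanSpace ℝ (Fin n) → ℝ, ConvexOn ℝ (convexHull ℝ Ω) Ψ ∧ EqOn ψ Ψ Ω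

/-- `det ∇²ψ(x)`, the Hessian being the derivative of the gradient. -/
def hessianDet {n : ℕ} (ψ : EuclideanSpace ℝ (Fin n) → ℝ) (x : EuclideanSpace ℝ (Fin n)) : ℝ :=
  (fderiv ℝ (∇ ψ) x).det

/-- The measure `f dx` on `Ω`. -/
def densityMeasure {n : ℕ} (Ω : Set (EuclideanSpace ℝ (Fin n)))
    (f : EuclideanSpace ℝ (Fin n) → ℝ) : Measure (EuclideanSpace ℝ (Fin n)) :=
  (volume.restrict Ω).withDensity (fun x => ENNReal.ofReal (f x))

/-- A Brenier potential from `μ = f dx` on `Ω` to `ν = g dx` on `Λ`, of class `C²` on `Ω`: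
a convex function whose gradient pushes `μ` forward to `ν`. -/
structure IsBrenierPotential {n : ℕ} (Ω Λ : Set (EuclideanSpace ℝ (Fin n)))
    (f g : EuclideanSpace ℝ (Fin n) → ℝ) (φ : EuclideanSpace ℝ (Fin n) → ℝ) : Prop where
  contDiffOn : ContDiffOn ℝ 2 φ Ω
  convex : ConvexFunctionOn Ω φ
  map_gradient : (densityMeasure Ω f).map (∇ φ) = densityMeasure Λ g

/-- The competitors: convex functions `ψ ∈ C²(Ω)` with `∇ψ(Ω) ⊆ Λ`. -/
def competitors {n : ℕ} (Ω Λ : Set (EuclideanSpace ℝ (Fin n))) :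
    Set (EuclideanSpace ℝ (Fin n) → ℝ) :=
  {ψ | ContDiffOn ℝ 2 ψ Ω ∧ ConvexFunctionOn Ω ψ ∧ MapsTo (∇ ψ) Ω Λ}

/-- `max {0, -log det ∇²ψ(x) - log g(∇ψ(x)) + log f(x)}`, with the value `+∞` where
`det ∇²ψ(x) = 0`. -/
def logDeficit {n : ℕ} (f g ψ : EuclideanSpace ℝ (Fin n) → ℝ)
    (x : EuclideanSpace ℝ (Fin n)) : ℝ≥0∞ :=
  (max 0 (-ENNReal.log (ENNReal.ofReal (hessianDet ψ x))
    - (Real.log (g (∇ ψ x)) : EReal) + (Real.log (f x) : EReal))).toENNReal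

/-- `max {0, -(det ∇²ψ(x))^{1/n} + (f(x) / g(∇ψ(x)))^{1/n}}`. -/
def rootDeficit {n : ℕ} (f g ψ : EuclideanSpace ℝ (Fin n) → ℝ)
    (x : EuclideanSpace ℝ (Fin n)) : ℝ≥0∞ :=
  ENNReal.ofReal (max 0 (-((hessianDet ψ x) ^ (1 / (n : ℝ)))
    + (f x / g (∇ ψ x)) ^ (1 / (n : ℝ))))

/-- The functional `∫_Ω max {0, -log det ∇²ψ - log g(∇ψ) + log f} dx`, with values in `[0, ∞]`. -/
def logObjective {n : ℕ} (Ω : Set (EuclideanSpace ℝ (Fin n)))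
    (f g ψ : EuclideanSpace ℝ (Fin n) → ℝ) : ℝ≥0∞ :=
  ∫⁻ x in Ω, logDeficit f g ψ x

/-- The functional `∫_Ω max {0, -(det ∇²ψ)^{1/n} + (f / g(∇ψ))^{1/n}} dx`. -/
def rootObjective {n : ℕ} (Ω : Set (EuclideanSpace ℝ (Fin n)))
    (f g ψ : EuclideanSpace ℝ (Fin n) → ℝ) : ℝ≥0∞ :=
  ∫⁻ x in Ω, rootDeficit f g ψ x

/-- The extension of a penalty `h : [0, ∞) → [0, ∞)` to `[0, ∞]` by `h(∞) = ∞`; this is the limit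
of `h` at infinity when `h` is convex and strictly increasing. -/
def extendPenalty (h : ℝ → ℝ) (t : ℝ≥0∞) : ℝ≥0∞ :=
  if t = ∞ then ∞ else ENNReal.ofReal (h t.toReal)

/-- The functional `∫_Ω h(max {0, -log det ∇²ψ - log g(∇ψ) + log f}) ρ dx`,
with values in `[0, ∞]`. -/
def penalizedObjective {n : ℕ} (Ω : Set (EuclideanSpace ℝ (Fin n)))
    (f g : EuclideanSpace ℝ (Fin n) → ℝ) (h : ℝ → ℝ) (ρ : EuclideanSpace ℝ (Fin n) → ℝ)
    (ψ : EuclideanSpace ℝ (Fin n) → ℝ) : ℝ≥0∞ :=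
  ∫⁻ x in Ω, extendPenalty h (logDeficit f g ψ x) * ENNReal.ofReal (ρ x)

/-- `φ` minimizes `F` over `J`, and every minimizer of `F` over `J` agrees with `φ` on `Ω` up to
one additive constant. -/
def IsUniqueMinimizerUpToConst {n : ℕ} (Ω : Set (EuclideanSpace ℝ (Fin n)))
    (J : Set (EuclideanSpace ℝ (Fin n) → ℝ)) (F : (EuclideanSpace ℝ (Fin n) → ℝ) → ℝ≥0∞)
    (φ : EuclideanSpace ℝ (Fin n) → ℝ) : Prop :=
  φ ∈ J ∧ IsMinOn F J φ ∧ ∀ ψ ∈ J, IsMinOn F J ψ → ∃ c : ℝ, ∀ x ∈ Ω, ψ x = φ x + c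

/-- `f` is bounded away from zero and infinity on `Ω`. -/
def BoundedAwayFromZeroAndInfinityOn {n : ℕ} (Ω : Set (EuclideanSpace ℝ (Fin n)))
    (f : EuclideanSpace ℝ (Fin n) → ℝ) : Prop :=
  ∃ m M : ℝ, 0 < m ∧ ∀ x ∈ Ω, m ≤ f x ∧ f x ≤ M

end MongeAmpere

end

open Filter Topology
open scoped RealInnerProductSpace

/-! Each integrand is nonnegative and vanishes exactly where `f ≤ det ∇²ψ · g(∇ψ)`. The Brenier
potential solves the Monge–Ampère equation with equality (`IsBrenierPotential.mongeAmpere`), so its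
value is `0`, the least possible, and every minimizer satisfies the inequality almost everywhere,
hence everywhere by continuity.

The inequality forces equality by mass balance: its Hessian determinant is positive, so `∇ψ` is
injective, and the change of variables shows that the push-forward of `f dx` is at most `g dx` on
`Λ`. The total masses agree, so `ψ` is itself a Brenier potential (`isBrenierPotential_of_le`).

It remains to see that Brenier potentials are unique up to one constant. Kantorovich duality gives
`∇φ = ∇ψ` (`IsBrenierPotential.gradient_eq`). As `Ω` may be disconnected, this yields a priori one
constant per component. The conjugates share subgradients on the convex set `Λ`, hence differ there
by a single constant, which passes back to `φ` and `ψ` (`IsBrenierPotential.eq_add_const`). -/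

namespace MongeAmpere

/-! ### Gradients and Hessians of convex functions on open sets -/

section Gradient

variable {n : ℕ} {Ω : Set (EuclideanSpace ℝ (Fin n))} {ψ : EuclideanSpace ℝ (Fin n) → ℝ}

theorem contDiffOn_gradient (hΩ : IsOpen Ω) (hψ : ContDiffOn ℝ 2 ψ Ω) :
    ContDiffOn ℝ 1 (∇ ψ) Ω :=
  (InnerProductSpace.toDual ℝ (EuclideanSpace ℝ (Fin n))).symm.contDiff.comp_contDiffOn
    (hψ.fderiv_of_isOpen hΩ (by norm_num))

theorem continuousOn_hessianDet (hΩ : IsOpen Ω) (hψ : ContDiffOn ℝ 2 ψ Ω) :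
    ContinuousOn (hessianDet ψ) Ω :=
  ContinuousLinearMap.continuous_det.comp_continuousOn
    ((contDiffOn_gradient hΩ hψ).continuousOn_fderiv_of_isOpen hΩ (by norm_num))

theorem differentiableAt_gradient (hΩ : IsOpen Ω) (hψ : ContDiffOn ℝ 2 ψ Ω)
    {x : EuclideanSpace ℝ (Fin n)} (hx : x ∈ Ω) : DifferentiableAt ℝ (∇ ψ) x :=
  ((contDiffOn_gradient hΩ hψ).contDiffAt (hΩ.mem_nhds hx)).differentiableAt (by norm_num)

theorem hasGradientAt_of_contDiffOn (hΩ : IsOpen Ω) (hψ : ContDiffOn ℝ 2 ψ Ω)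
    {x : EuclideanSpace ℝ (Fin n)} (hx : x ∈ Ω) : HasGradientAt ψ (∇ ψ x) x :=
  ((hψ.contDiffAt (hΩ.mem_nhds hx)).differentiableAt (by norm_num)).hasGradientAt

theorem tendsto_add_smul (x v : EuclideanSpace ℝ (Fin n)) :
    Tendsto (fun t : ℝ => x + t • v) (𝓝 0) (𝓝 x) := by
  have : Continuous fun t : ℝ => x + t • v := by fun_prop
  simpa using this.tendsto 0

theorem HasGradientAt.eq_of_subgradient {p q x : EuclideanSpace ℝ (Fin n)} (hΩ : IsOpen Ω)
    (hx : x ∈ Ω) (hp : HasGradientAt ψ p x) (hq : ∀ z ∈ Ω, ψ x + ⟪q, z - x⟫ ≤ ψ z) : p = q := by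
  have hmin : IsLocalMin (fun z => ψ z - InnerProductSpace.toDual ℝ _ q z) x := by
    filter_upwards [hΩ.mem_nhds hx] with z hz
    have := hq z hz
    rw [inner_sub_right] at this
    simp only [InnerProductSpace.toDual_apply_apply]
    linarith
  have h := hmin.hasFDerivAt_eq_zero
    ((hasGradientAt_iff_hasFDerivAt.1 hp).sub (InnerProductSpace.toDual ℝ _ q).hasFDerivAt)
  exact (InnerProductSpace.toDual ℝ _).injective (sub_eq_zero.1 h)

theorem ConvexFunctionOn.le_combination (hψ : ConvexFunctionOn Ω ψ)
    {x y : EuclideanSpace ℝ (Fin n)} (hx : x ∈ Ω) (hy : y ∈ Ω) {t : ℝ} (ht0 : 0 ≤ t) (ht1 : t ≤ 1)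
    (hxy : x + t • (y - x) ∈ Ω) : ψ (x + t • (y - x)) ≤ (1 - t) * ψ x + t * ψ y := by
  obtain ⟨Ψ, hΨ, he⟩ := hψ
  rw [he hx, he hy, he hxy]
  have h := hΨ.2 (subset_convexHull ℝ Ω hx) (subset_convexHull ℝ Ω hy) (sub_nonneg.2 ht1) ht0
    (by ring)
  have hc : x + t • (y - x) = (1 - t) • x + t • y := by module
  rw [hc]
  simpa using h

theorem ConvexFunctionOn.subgradient (hΩ : IsOpen Ω) (hψ : ConvexFunctionOn Ω ψ)
    {p x z : EuclideanSpace ℝ (Fin n)} (hx : x ∈ Ω) (hz : z ∈ Ω) (hp : HasGradientAt ψ p x) :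
    ψ x + ⟪p, z - x⟫ ≤ ψ z := by
  have ht := ((hasGradientAt_iff_hasFDerivAt.1 hp).hasLineDerivAt (z - x)).tendsto_slope_zero_right
  rw [InnerProductSpace.toDual_apply_apply] at ht
  have hle : ⟪p, z - x⟫ ≤ ψ z - ψ x := by
    refine le_of_tendsto ht ?_
    filter_upwards [self_mem_nhdsWithin, nhdsWithin_le_nhds (gt_mem_nhds one_pos),
      nhdsWithin_le_nhds (tendsto_add_smul x (z - x) (hΩ.mem_nhds hx))] with t ht0 ht1 htΩ
    have ht0 : 0 < t := ht0
    have h := hψ.le_combination hx hz ht0.le ht1.le htΩ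
    rw [smul_eq_mul, inv_mul_le_iff₀ ht0]
    linarith
  linarith

theorem ConvexFunctionOn.gradient_monotone (hΩ : IsOpen Ω) (hc : ContDiffOn ℝ 2 ψ Ω)
    (hψ : ConvexFunctionOn Ω ψ) {x y : EuclideanSpace ℝ (Fin n)} (hx : x ∈ Ω) (hy : y ∈ Ω) :
    0 ≤ ⟪∇ ψ y - ∇ ψ x, y - x⟫ := by
  have h1 := hψ.subgradient hΩ hx hy (hasGradientAt_of_contDiffOn hΩ hc hx)
  have h2 := hψ.subgradient hΩ hy hx (hasGradientAt_of_contDiffOn hΩ hc hy)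
  rw [← neg_sub y x, inner_neg_right] at h2
  rw [inner_sub_left]
  linarith

theorem ConvexFunctionOn.inner_fderiv_gradient_nonneg (hΩ : IsOpen Ω) (hc : ContDiffOn ℝ 2 ψ Ω)
    (hψ : ConvexFunctionOn Ω ψ) {x : EuclideanSpace ℝ (Fin n)} (hx : x ∈ Ω)
    (v : EuclideanSpace ℝ (Fin n)) : 0 ≤ ⟪fderiv ℝ (∇ ψ) x v, v⟫ := by
  have ht := ((differentiableAt_gradient hΩ hc hx).hasFDerivAt.hasLineDerivAt
    v).tendsto_slope_zero_right
  refine ge_of_tendsto (ht.inner (tendsto_const_nhds (x := v))) ?_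
  filter_upwards [self_mem_nhdsWithin,
    nhdsWithin_le_nhds (tendsto_add_smul x v (hΩ.mem_nhds hx))] with t ht0 htΩ
  have ht0 : 0 < t := ht0
  have h := hψ.gradient_monotone hΩ hc hx htΩ
  rw [add_sub_cancel_left, inner_smul_right] at h
  rw [inner_smul_left]
  have := nonneg_of_mul_nonneg_right h ht0
  have hi : 0 < t⁻¹ := inv_pos.2 ht0
  simpa using mul_nonneg hi.le this

/-- No symmetry of `A` is needed: on the segment from the identity to `A` the quadratic form is
positive definite before the endpoint, so the determinant starts at `1` and cannot vanish there. -/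
theorem det_nonneg_of_inner_nonneg {A : EuclideanSpace ℝ (Fin n) →L[ℝ] EuclideanSpace ℝ (Fin n)}
    (hA : ∀ v, 0 ≤ ⟪A v, v⟫) : 0 ≤ A.det := by
  set B : ℝ → (EuclideanSpace ℝ (Fin n) →L[ℝ] EuclideanSpace ℝ (Fin n)) :=
    fun s => s • A + (1 - s) • ContinuousLinearMap.id ℝ _ with hB
  have hcont : Continuous fun s => (B s).det :=
    ContinuousLinearMap.continuous_det.comp (by fun_prop)
  have hne : ∀ s ∈ Ico (0 : ℝ) 1, (B s).det ≠ 0 := by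
    intro s hs h0
    obtain ⟨v, hv, hv0⟩ := (Submodule.ne_bot_iff _).1 (LinearMap.bot_lt_ker_of_det_eq_zero h0).ne'
    have hv' : s • A v + (1 - s) • v = 0 := by simpa [hB] using hv
    have h2 := congrArg (fun w => ⟪w, v⟫) hv'
    simp only [inner_add_left, inner_smul_left, inner_zero_left, RCLike.conj_to_real,
      real_inner_self_eq_norm_sq] at h2
    have h3 : 0 < ‖v‖ ^ 2 := by positivity
    have h4 := mul_nonneg hs.1 (hA v)
    have h5 := mul_pos (sub_pos.2 hs.2) h3
    linarith
  have hpos : ∀ s ∈ Ico (0 : ℝ) 1, 0 < (B s).det := by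
    intro s hs
    by_contra hneg
    have h0 : (B 0).det = 1 := by simp [hB, ContinuousLinearMap.det]
    obtain ⟨r, hr, hr0⟩ := intermediate_value_Icc' hs.1 hcont.continuousOn
      (show (0 : ℝ) ∈ Icc (B s).det (B 0).det from ⟨not_lt.1 hneg, by rw [h0]; norm_num⟩)
    exact hne r ⟨hr.1, hr.2.trans_lt hs.2⟩ hr0
  have h1 : B 1 = A := by ext v; simp [hB]
  rw [← h1]
  refine ge_of_tendsto (hcont.continuousWithinAt (s := Iio 1) (x := 1)) ?_
  filter_upwards [self_mem_nhdsWithin, nhdsWithin_le_nhds (lt_mem_nhds one_pos)] with s h1 h0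
  exact (hpos s ⟨le_of_lt h0, h1⟩).le

theorem ConvexFunctionOn.hessianDet_nonneg (hΩ : IsOpen Ω) (hc : ContDiffOn ℝ 2 ψ Ω)
    (hψ : ConvexFunctionOn Ω ψ) {x : EuclideanSpace ℝ (Fin n)} (hx : x ∈ Ω) :
    0 ≤ hessianDet ψ x :=
  det_nonneg_of_inner_nonneg (hψ.inner_fderiv_gradient_nonneg hΩ hc hx)

/-- The gradient takes its value at a point with nonsingular Hessian nowhere else: a convex
function is affine along a segment joining two points with the same gradient. -/
theorem ConvexFunctionOn.eq_of_gradient_eq (hΩ : IsOpen Ω) (hc : ContDiffOn ℝ 2 ψ Ω)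
    (hψ : ConvexFunctionOn Ω ψ) {x y : EuclideanSpace ℝ (Fin n)} (hx : x ∈ Ω) (hy : y ∈ Ω)
    (hdet : hessianDet ψ x ≠ 0) (hxy : ∇ ψ x = ∇ ψ y) : x = y := by
  by_contra hne
  have hsx := fun z hz => hψ.subgradient hΩ (z := z) hx hz (hasGradientAt_of_contDiffOn hΩ hc hx)
  have hsy := hψ.subgradient hΩ hy hx (hasGradientAt_of_contDiffOn hΩ hc hy)
  rw [← hxy, ← neg_sub y x, inner_neg_right] at hsy
  have hval : ψ y = ψ x + ⟪∇ ψ x, y - x⟫ := le_antisymm (by linarith) (hsx y hy)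
  -- On the segment `ψ` touches its supporting affine function at `x`, which therefore supports `ψ`
  -- there too. Only small `t` are used, since the segment may leave `Ω`.
  have hconst : ∀ᶠ t : ℝ in 𝓝[>] 0, ∇ ψ (x + t • (y - x)) = ∇ ψ x := by
    filter_upwards [self_mem_nhdsWithin, nhdsWithin_le_nhds (gt_mem_nhds one_pos),
      nhdsWithin_le_nhds (tendsto_add_smul x (y - x) (hΩ.mem_nhds hx))] with t ht0 ht1 htΩ
    refine HasGradientAt.eq_of_subgradient hΩ htΩ (hasGradientAt_of_contDiffOn hΩ hc htΩ) ?_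
    intro z hz
    have h := hψ.le_combination hx hy (le_of_lt ht0) ht1.le htΩ
    have h2 := hsx z hz
    rw [hval] at h
    have h3 : ⟪∇ ψ x, z - (x + t • (y - x))⟫ = ⟪∇ ψ x, z - x⟫ - t * ⟪∇ ψ x, y - x⟫ := by
      rw [← inner_smul_right, ← inner_sub_right]
      congr 1
      abel
    rw [h3]
    linarith
  have ht := ((differentiableAt_gradient hΩ hc hx).hasFDerivAt.hasLineDerivAt
    (y - x)).tendsto_slope_zero_right
  have hzero : fderiv ℝ (∇ ψ) x (y - x) = 0 := by
    refine tendsto_nhds_unique (ht.congr' ?_) tendsto_const_nhds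
    filter_upwards [hconst] with t ht
    simp [ht]
  exact sub_ne_zero.2 (Ne.symm hne)
    ((LinearMap.equivOfDetNeZero _ hdet).injective (hzero.trans (map_zero _).symm))

end Gradient

/-! ### The Monge–Ampère equation and push-forwards -/

section MongeAmpereEquation

variable {n : ℕ} {Ω Λ : Set (EuclideanSpace ℝ (Fin n))} {f g : EuclideanSpace ℝ (Fin n) → ℝ}
  {φ ψ : EuclideanSpace ℝ (Fin n) → ℝ}

theorem densityMeasure_apply {B : Set (EuclideanSpace ℝ (Fin n))} (hB : MeasurableSet B) :
    densityMeasure Ω f B = ∫⁻ x in B ∩ Ω, ENNReal.ofReal (f x) := by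
  rw [densityMeasure, withDensity_apply _ hB, Measure.restrict_restrict hB]

theorem densityMeasure_apply_indicator {B : Set (EuclideanSpace ℝ (Fin n))}
    (hB : MeasurableSet B) (hΩ : MeasurableSet Ω) :
    densityMeasure Ω f B = ∫⁻ x in B, Ω.indicator (fun x => ENNReal.ofReal (f x)) x := by
  rw [densityMeasure_apply hB, setLIntegral_indicator hΩ, inter_comm]

theorem densityMeasure_absolutelyContinuous :
    densityMeasure Ω f ≪ volume.restrict Ω :=
  withDensity_absolutelyContinuous _ _

theorem measurable_indicator_ofReal (hΛ : IsOpen Λ) (hg : ContinuousOn g Λ) :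
    Measurable (Λ.indicator fun y => ENNReal.ofReal (g y)) := by
  classical
  rw [← piecewise_eq_indicator]
  exact (ENNReal.continuous_ofReal.comp_continuousOn hg).measurable_piecewise
    continuousOn_const hΛ.measurableSet

theorem aemeasurable_gradient (hΩ : IsOpen Ω) (hψ : ContDiffOn ℝ 2 ψ Ω) :
    AEMeasurable (∇ ψ) (volume.restrict Ω) :=
  (contDiffOn_gradient hΩ hψ).continuousOn.aemeasurable hΩ.measurableSet

theorem lintegral_ofReal_ne_top (hΩ_bdd : Bornology.IsBounded Ω)
    (hf : BoundedAwayFromZeroAndInfinityOn Ω f) : ∫⁻ x in Ω, ENNReal.ofReal (f x) ≠ ∞ := by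
  obtain ⟨m, M, -, h⟩ := hf
  refine ((setLIntegral_mono measurable_const fun _ hx =>
    ENNReal.ofReal_le_ofReal (h _ hx).2).trans_lt ?_).ne
  rw [setLIntegral_const]
  exact ENNReal.mul_lt_top ENNReal.ofReal_lt_top hΩ_bdd.measure_lt_top

theorem lintegral_image_gradient (hΩ : IsOpen Ω) (hψ : ContDiffOn ℝ 2 ψ Ω)
    {A : Set (EuclideanSpace ℝ (Fin n))} (hA : MeasurableSet A) (hAΩ : A ⊆ Ω)
    (hinj : InjOn (∇ ψ) A) (u : EuclideanSpace ℝ (Fin n) → ℝ≥0∞) :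
    ∫⁻ y in ∇ ψ '' A, u y = ∫⁻ x in A, ENNReal.ofReal |hessianDet ψ x| * u (∇ ψ x) :=
  lintegral_image_eq_lintegral_abs_det_fderiv_mul volume hA
    (fun _ hx =>
      (differentiableAt_gradient hΩ hψ (hAΩ hx)).hasFDerivAt.hasFDerivWithinAt) hinj u

/-- The gradient maps the singular set to a null set (Sard), which has no mass for `g dx`; so the
singular set has no mass for `f dx`, and `f > 0`. -/
theorem IsBrenierPotential.ae_hessianDet_ne_zero (hΩ : IsOpen Ω)
    (hf_cont : ContinuousOn f Ω) (hf_pos : ∀ x ∈ Ω, 0 < f x)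
    (hφ : IsBrenierPotential Ω Λ f g φ) :
    volume (Ω ∩ {x | hessianDet φ x = 0}) = 0 := by
  set Z := Ω ∩ {x | hessianDet φ x = 0}
  have himage : volume (∇ φ '' Z) = 0 :=
    addHaar_image_eq_zero_of_det_fderivWithin_eq_zero volume
      (f' := fderiv ℝ (∇ φ)) (fun x hx =>
        (differentiableAt_gradient hΩ hφ.contDiffOn hx.1).hasFDerivAt.hasFDerivWithinAt)
      (fun _ hx => hx.2)
  have hnull : densityMeasure Λ g (toMeasurable volume (∇ φ '' Z)) = 0 :=
    (densityMeasure_absolutelyContinuous.trans Measure.restrict_le_self.absolutelyContinuous)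
      (by rwa [measure_toMeasurable])
  rw [← hφ.map_gradient, Measure.map_apply_of_aemeasurable
    ((aemeasurable_gradient hΩ hφ.contDiffOn).mono_ac densityMeasure_absolutelyContinuous)
    (measurableSet_toMeasurable _ _)] at hnull
  have hsub : Z ⊆ ∇ φ ⁻¹' toMeasurable volume (∇ φ '' Z) :=
    image_subset_iff.1 (subset_toMeasurable _ _)
  have hZ0 : densityMeasure Ω f Z = 0 := measure_mono_null hsub hnull
  have hac : volume.restrict Ω ≪ densityMeasure Ω f := by
    refine withDensity_absolutelyContinuous'
      (hf_cont.aemeasurable hΩ.measurableSet).ennreal_ofReal ?_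
    filter_upwards [ae_restrict_mem hΩ.measurableSet] with x hx
    exact (ENNReal.ofReal_pos.2 (hf_pos x hx)).ne'
  have := hac hZ0
  rwa [Measure.restrict_apply' hΩ.measurableSet, inter_eq_left.2 inter_subset_left] at this

theorem measurableSet_hessianDet_ne_zero (hΩ : IsOpen Ω) (hψ : ContDiffOn ℝ 2 ψ Ω) :
    MeasurableSet (Ω ∩ {x | hessianDet ψ x ≠ 0}) :=
  ((continuousOn_hessianDet hΩ hψ).isOpen_inter_preimage hΩ isOpen_ne).measurableSet

/-- Off the singular set `∇φ` is injective, so the change of variables equates the integrals of both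
sides over every measurable subset. The indicator is there because `∇φ(x) ∈ Λ` is not yet known. -/
theorem IsBrenierPotential.ae_mongeAmpere (hΩ : IsOpen Ω) (hΩ_bdd : Bornology.IsBounded Ω)
    (hΛ : IsOpen Λ) (hf_cont : ContinuousOn f Ω) (hg_cont : ContinuousOn g Λ)
    (hf : BoundedAwayFromZeroAndInfinityOn Ω f) (hφ : IsBrenierPotential Ω Λ f g φ) :
    ∀ᵐ x ∂volume.restrict Ω, ENNReal.ofReal (f x) = ENNReal.ofReal |hessianDet φ x| *
      Λ.indicator (fun y => ENNReal.ofReal (g y)) (∇ φ x) := by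
  have hf_pos : ∀ x ∈ Ω, 0 < f x := by
    obtain ⟨m, M, hm, h⟩ := hf
    exact fun x hx => hm.trans_le (h x hx).1
  set D := Ω ∩ {x | hessianDet φ x ≠ 0} with hD
  have hDm : MeasurableSet D := measurableSet_hessianDet_ne_zero hΩ hφ.contDiffOn
  have hDae : volume.restrict Ω = volume.restrict D := by
    refine Measure.restrict_congr_set ?_
    refine (ae_eq_set.2 ⟨measure_mono_null ?_
      (hφ.ae_hessianDet_ne_zero hΩ hf_cont hf_pos), ?_⟩)
    · intro x hx
      exact ⟨hx.1, by_contra fun h => hx.2 ⟨hx.1, h⟩⟩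
    · rw [sdiff_eq_empty.2 inter_subset_left, measure_empty]
  have hset : ∀ A, MeasurableSet A → A ⊆ D → ∫⁻ x in A, ENNReal.ofReal (f x) =
      ∫⁻ x in A, ENNReal.ofReal |hessianDet φ x| *
        Λ.indicator (fun y => ENNReal.ofReal (g y)) (∇ φ x) := by
    intro A hA hAD
    have hAΩ : A ⊆ Ω := hAD.trans inter_subset_left
    have hinj : InjOn (∇ φ) A := fun x hx y hy hxy =>
      hφ.convex.eq_of_gradient_eq hΩ hφ.contDiffOn (hAΩ hx) (hAΩ hy) (hAD hx).2 hxy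
    have himage : MeasurableSet (∇ φ '' A) := hA.image_of_continuousOn_injOn
      ((contDiffOn_gradient hΩ hφ.contDiffOn).continuousOn.mono hAΩ) hinj
    rw [← lintegral_image_gradient hΩ hφ.contDiffOn hA hAΩ hinj,
      ← densityMeasure_apply_indicator himage hΛ.measurableSet, ← hφ.map_gradient,
      Measure.map_apply_of_aemeasurable ((aemeasurable_gradient hΩ hφ.contDiffOn).mono_ac
        densityMeasure_absolutelyContinuous) himage, densityMeasure,
      withDensity_apply' , Measure.restrict_restrict' hΩ.measurableSet]
    congr 2
    -- Within `Ω`, the preimage of `∇φ '' A` is `A` itself: a gradient value attained at a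
    -- nonsingular point is attained nowhere else.
    ext x
    constructor
    · exact fun hx => ⟨mem_image_of_mem _ hx, hAΩ hx⟩
    · rintro ⟨⟨z, hz, hzx⟩, hx⟩
      rwa [← hφ.convex.eq_of_gradient_eq hΩ hφ.contDiffOn (hAΩ hz) hx (hAD hz).2 hzx]
  rw [hDae]
  have hfin : ∫⁻ x in D, ENNReal.ofReal (f x) ≠ ∞ :=
    ((lintegral_mono_set inter_subset_left).trans_lt
      (lintegral_ofReal_ne_top hΩ_bdd hf).lt_top).ne
  refine AEMeasurable.ae_eq_of_forall_setLIntegral_eq ?_ ?_ hfin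
    (hset D hDm le_rfl ▸ hfin) ?_
  · exact ((hf_cont.mono inter_subset_left).aemeasurable hDm).ennreal_ofReal
  · rw [← hDae]
    have h1 := (continuousOn_hessianDet hΩ hφ.contDiffOn).abs.aemeasurable
      (μ := volume) hΩ.measurableSet
    exact h1.ennreal_ofReal.mul ((measurable_indicator_ofReal hΛ hg_cont).comp_aemeasurable
      (aemeasurable_gradient hΩ hφ.contDiffOn))
  · intro A hA _
    rw [Measure.restrict_restrict hA]
    exact hset _ (hA.inter hDm) inter_subset_right

theorem IsBrenierPotential.ae_gradient_mem (hΩ : IsOpen Ω) (hΩ_bdd : Bornology.IsBounded Ω)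
    (hΛ : IsOpen Λ) (hf_cont : ContinuousOn f Ω) (hg_cont : ContinuousOn g Λ)
    (hf : BoundedAwayFromZeroAndInfinityOn Ω f) (hg : BoundedAwayFromZeroAndInfinityOn Λ g)
    (hφ : IsBrenierPotential Ω Λ f g φ) :
    ∀ᵐ x ∂volume.restrict Ω, ∇ φ x ∈ Λ ∧ hessianDet φ x * g (∇ φ x) = f x := by
  obtain ⟨m, M, hm, hfm⟩ := id hf
  obtain ⟨m', M', hm', hgm⟩ := hg
  filter_upwards [hφ.ae_mongeAmpere hΩ hΩ_bdd hΛ hf_cont hg_cont hf,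
    ae_restrict_mem hΩ.measurableSet] with x hx hxΩ
  have hfx := hm.trans_le (hfm x hxΩ).1
  have hmem : ∇ φ x ∈ Λ := by
    by_contra hnot
    rw [indicator_of_notMem hnot, mul_zero, ENNReal.ofReal_eq_zero] at hx
    linarith
  refine ⟨hmem, ?_⟩
  have hgx := hm'.trans_le (hgm _ hmem).1
  have hdet := hφ.convex.hessianDet_nonneg hΩ hφ.contDiffOn hxΩ
  rw [indicator_of_mem hmem, abs_of_nonneg hdet, ← ENNReal.ofReal_mul hdet] at hx
  exact ((ENNReal.ofReal_eq_ofReal_iff hfx.le (mul_nonneg hdet hgx.le)).1 hx).symm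

theorem eqOn_zero_of_ae {u : EuclideanSpace ℝ (Fin n) → ℝ} (hΩ : IsOpen Ω)
    (hu : ContinuousOn u Ω) (h : ∀ᵐ x ∂volume.restrict Ω, u x = 0) : ∀ x ∈ Ω, u x = 0 :=
  Measure.eqOn_open_of_ae_eq (μ := volume) (g := fun _ => (0 : ℝ)) h hΩ hu continuousOn_const

theorem forall_mem_closed_of_ae {K : Set (EuclideanSpace ℝ (Fin n))} (hΩ : IsOpen Ω)
    (hψ : ContDiffOn ℝ 2 ψ Ω) (hK : IsClosed K) (h : ∀ᵐ x ∂volume.restrict Ω, ∇ ψ x ∈ K) :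
    MapsTo (∇ ψ) Ω K := by
  -- `Metric.infDist` to the empty set is `0` by convention, so this case is separate.
  rcases K.eq_empty_or_nonempty with rfl | hne
  · have : volume Ω = 0 := by
      rw [← Measure.restrict_eq_zero, ← ae_eq_bot]
      exact eventually_false_iff_eq_bot.1 h
    rw [(hΩ.measure_eq_zero_iff volume).1 this]
    exact mapsTo_empty _ _
  intro x hx
  rw [hK.mem_iff_infDist_zero hne]
  refine eqOn_zero_of_ae (u := fun x => Metric.infDist (∇ ψ x) K) hΩ ?_ ?_ x hx
  · exact (Metric.continuous_infDist_pt K).comp_continuousOn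
      (contDiffOn_gradient hΩ hψ).continuousOn
  · filter_upwards [h] with x hx using Metric.infDist_zero_of_mem hx

theorem isOpen_image_gradient (hΩ : IsOpen Ω) (hψ : ContDiffOn ℝ 2 ψ Ω)
    (hdet : ∀ x ∈ Ω, hessianDet ψ x ≠ 0) : IsOpen (∇ ψ '' Ω) := by
  rw [isOpen_iff_mem_nhds]
  rintro _ ⟨x, hx, rfl⟩
  have hs := (((contDiffOn_gradient hΩ hψ).contDiffAt (hΩ.mem_nhds hx)).hasStrictFDerivAt
    (by norm_num)).map_nhds_eq_of_surj
    (LinearMap.range_eq_top.2 (LinearMap.equivOfDetNeZero _ (hdet x hx)).surjective)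
  rw [← hs]
  exact image_mem_map (hΩ.mem_nhds hx)

/-- Continuity puts the gradients in `closure Λ`, and continuity of `g` up to the boundary extends
the equation to all of `Ω`. The Hessian is then nonsingular, so the image is open and lies in the
interior of `closure Λ`, which is `Λ` by convexity. -/
theorem IsBrenierPotential.mongeAmpere (hΩ : IsOpen Ω) (hΩ_bdd : Bornology.IsBounded Ω)
    (hΛ : IsOpen Λ) (hΛ_convex : Convex ℝ Λ)
    (hf_cont : ContinuousOn f Ω) (hg_cont : ContinuousOn g (closure Λ))
    (hf : BoundedAwayFromZeroAndInfinityOn Ω f) (hg : BoundedAwayFromZeroAndInfinityOn Λ g)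
    (hφ : IsBrenierPotential Ω Λ f g φ) :
    MapsTo (∇ φ) Ω Λ ∧ ∀ x ∈ Ω, hessianDet φ x * g (∇ φ x) = f x := by
  have hae := hφ.ae_gradient_mem hΩ hΩ_bdd hΛ hf_cont (hg_cont.mono subset_closure) hf hg
  have hclosure : MapsTo (∇ φ) Ω (closure Λ) := forall_mem_closed_of_ae hΩ hφ.contDiffOn
    isClosed_closure (hae.mono fun x hx => subset_closure hx.1)
  have heq : ∀ x ∈ Ω, hessianDet φ x * g (∇ φ x) = f x := by
    refine Measure.eqOn_open_of_ae_eq (μ := volume) (f := fun x => hessianDet φ x * g (∇ φ x))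
      (hae.mono fun x hx => hx.2) hΩ ?_ hf_cont
    exact (continuousOn_hessianDet hΩ hφ.contDiffOn).mul
      (hg_cont.comp (contDiffOn_gradient hΩ hφ.contDiffOn).continuousOn hclosure)
  refine ⟨?_, heq⟩
  obtain ⟨m, M, hm, hfm⟩ := hf
  have hopen := isOpen_image_gradient hΩ hφ.contDiffOn fun x hx h0 => by
    have h1 := heq x hx
    rw [h0, zero_mul] at h1
    linarith [(hfm x hx).1]
  intro x hx
  have hmem : ∇ φ x ∈ interior (closure Λ) :=
    interior_maximal hclosure.image_subset hopen (mem_image_of_mem _ hx)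
  have hne : (interior Λ).Nonempty := by
    rw [hΛ.interior_eq]
    exact closure_nonempty_iff.1 ⟨_, hclosure hx⟩
  rwa [hΛ_convex.interior_closure_eq_interior_of_nonempty_interior hne, hΛ.interior_eq] at hmem

theorem isBrenierPotential_of_le (hΩ : IsOpen Ω) (hΩ_bdd : Bornology.IsBounded Ω)
    (hf : BoundedAwayFromZeroAndInfinityOn Ω f)
    (h_mass : ∫⁻ x in Ω, ENNReal.ofReal (f x) = ∫⁻ y in Λ, ENNReal.ofReal (g y))
    (hψ : ψ ∈ competitors Ω Λ)
    (hle : ∀ x ∈ Ω, f x ≤ hessianDet ψ x * g (∇ ψ x)) :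
    IsBrenierPotential Ω Λ f g ψ := by
  obtain ⟨hc, hconv, hmaps⟩ := hψ
  obtain ⟨m, M, hm, hfm⟩ := id hf
  have hdet : ∀ x ∈ Ω, hessianDet ψ x ≠ 0 := fun x hx h0 => by
    have h1 := hle x hx
    rw [h0, zero_mul] at h1
    linarith [(hfm x hx).1]
  have hmeas : AEMeasurable (∇ ψ) (densityMeasure Ω f) :=
    (aemeasurable_gradient hΩ hc).mono_ac densityMeasure_absolutelyContinuous
  have hcont := (contDiffOn_gradient hΩ hc).continuousOn
  refine ⟨hc, hconv, ?_⟩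
  have : IsFiniteMeasure (densityMeasure Ω f) := ⟨by
    rw [densityMeasure_apply MeasurableSet.univ, univ_inter]
    exact (lintegral_ofReal_ne_top hΩ_bdd hf).lt_top⟩
  refine Measure.eq_of_le_of_measure_univ_eq (Measure.le_iff.2 fun B hB => ?_) ?_
  · set A := Ω ∩ ∇ ψ ⁻¹' B
    have hinj : InjOn (∇ ψ) A := fun x hx y hy hxy =>
      hconv.eq_of_gradient_eq hΩ hc hx.1 hy.1 (hdet x hx.1) hxy
    have hA : MeasurableSet A := by
      classical
      have h := (hcont.measurable_piecewise (g := fun _ => 0) continuousOn_const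
        hΩ.measurableSet) hB
      have hAeq : A = Ω ∩ (Ω.piecewise (∇ ψ) fun _ => 0) ⁻¹' B := by
        ext x
        refine and_congr_right fun hx => ?_
        simp [piecewise_eq_of_mem _ _ _ hx]
      rw [hAeq]
      exact hΩ.measurableSet.inter h
    have himage : ∇ ψ '' A ⊆ B ∩ Λ := by
      rintro _ ⟨x, hx, rfl⟩
      exact ⟨hx.2, hmaps hx.1⟩
    rw [Measure.map_apply_of_aemeasurable hmeas hB, densityMeasure, withDensity_apply',
      Measure.restrict_restrict' hΩ.measurableSet, inter_comm, densityMeasure_apply hB]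
    calc ∫⁻ x in A, ENNReal.ofReal (f x)
        ≤ ∫⁻ x in A, ENNReal.ofReal |hessianDet ψ x| * ENNReal.ofReal (g (∇ ψ x)) := by
          refine setLIntegral_mono' hA fun x hx => ?_
          have hnn := hconv.hessianDet_nonneg hΩ hc hx.1
          rw [abs_of_nonneg hnn, ← ENNReal.ofReal_mul hnn]
          exact ENNReal.ofReal_le_ofReal (hle x hx.1)
      _ = ∫⁻ y in ∇ ψ '' A, ENNReal.ofReal (g y) :=
          (lintegral_image_gradient hΩ hc hA inter_subset_left hinj
            fun y => ENNReal.ofReal (g y)).symm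
      _ ≤ _ := lintegral_mono_set himage
  · rw [Measure.map_apply_of_aemeasurable hmeas MeasurableSet.univ, preimage_univ,
      densityMeasure_apply MeasurableSet.univ, densityMeasure_apply MeasurableSet.univ,
      univ_inter, univ_inter, h_mass]

/-- A nonempty open part of `Λ` missed by the gradient would have positive mass for `g dx` but none
for the push-forward. -/
theorem IsBrenierPotential.subset_closure_image (hΩ : IsOpen Ω) (hΛ : IsOpen Λ)
    (hg_cont : ContinuousOn g Λ) (hg : BoundedAwayFromZeroAndInfinityOn Λ g)
    (hφ : IsBrenierPotential Ω Λ f g φ) : Λ ⊆ closure (∇ φ '' Ω) := by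
  obtain ⟨m, M, hm, hgm⟩ := hg
  have hW : IsOpen (closure (∇ φ '' Ω))ᶜ := isClosed_closure.isOpen_compl
  have h0 : densityMeasure Λ g (closure (∇ φ '' Ω))ᶜ = 0 := by
    rw [← hφ.map_gradient, Measure.map_apply_of_aemeasurable
      ((aemeasurable_gradient hΩ hφ.contDiffOn).mono_ac densityMeasure_absolutelyContinuous)
      hW.measurableSet]
    refine densityMeasure_absolutelyContinuous ?_
    rw [Measure.restrict_apply' hΩ.measurableSet]
    convert measure_empty (μ := volume)
    exact eq_empty_of_forall_notMem fun x hx =>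
      hx.1 (subset_closure (mem_image_of_mem _ hx.2))
  have hac : volume.restrict Λ ≪ densityMeasure Λ g := by
    refine withDensity_absolutelyContinuous'
      (hg_cont.aemeasurable hΛ.measurableSet).ennreal_ofReal ?_
    filter_upwards [ae_restrict_mem hΛ.measurableSet] with x hx
    exact (ENNReal.ofReal_pos.2 (hm.trans_le (hgm x hx).1)).ne'
  have h1 := hac h0
  rw [Measure.restrict_apply hW.measurableSet, (hW.inter hΛ).measure_eq_zero_iff volume] at h1
  intro y hy
  by_contra hnot
  exact (eq_empty_iff_forall_notMem.1 h1 y) ⟨hnot, hy⟩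

end MongeAmpereEquation

/-! ### Convex conjugates and uniqueness of Brenier potentials -/

section Conjugate

variable {n : ℕ} {Ω Λ : Set (EuclideanSpace ℝ (Fin n))} {f g : EuclideanSpace ℝ (Fin n) → ℝ}
  {φ ψ : EuclideanSpace ℝ (Fin n) → ℝ}

/-- The convex conjugate of `φ`, the supremum being taken over `Ω`. -/
noncomputable def conjugate (Ω : Set (EuclideanSpace ℝ (Fin n)))
    (φ : EuclideanSpace ℝ (Fin n) → ℝ) (p : EuclideanSpace ℝ (Fin n)) : ℝ :=
  sSup ((fun x => ⟪x, p⟫ - φ x) '' Ω)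

/-- The real `sSup` is meaningful only for bounded sets. One supporting affine function of `φ` and
the boundedness of `Ω` give the bound. -/
theorem bddAbove_conjugate (hΩ : IsOpen Ω) (hΩ_bdd : Bornology.IsBounded Ω)
    (hc : ContDiffOn ℝ 2 φ Ω) (hconv : ConvexFunctionOn Ω φ) (p : EuclideanSpace ℝ (Fin n)) :
    BddAbove ((fun x => ⟪x, p⟫ - φ x) '' Ω) := by
  rcases Ω.eq_empty_or_nonempty with rfl | ⟨x₀, hx₀⟩
  · simp
  obtain ⟨R, hR⟩ := hΩ_bdd.exists_norm_le
  refine ⟨R * ‖p - ∇ φ x₀‖ + ⟪∇ φ x₀, x₀⟫ - φ x₀, ?_⟩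
  rintro _ ⟨x, hx, rfl⟩
  have h1 := hconv.subgradient hΩ hx₀ hx (hasGradientAt_of_contDiffOn hΩ hc hx₀)
  have h2 := (real_inner_le_norm x (p - ∇ φ x₀)).trans
    (mul_le_mul_of_nonneg_right (hR x hx) (norm_nonneg _))
  rw [inner_sub_right] at h1 h2
  rw [real_inner_comm] at h1
  have h3 := real_inner_comm x (∇ φ x₀)
  simp only
  linarith

theorem le_conjugate (hΩ : IsOpen Ω) (hΩ_bdd : Bornology.IsBounded Ω)
    (hc : ContDiffOn ℝ 2 φ Ω) (hconv : ConvexFunctionOn Ω φ) {x : EuclideanSpace ℝ (Fin n)}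
    (hx : x ∈ Ω) (p : EuclideanSpace ℝ (Fin n)) : ⟪x, p⟫ - φ x ≤ conjugate Ω φ p :=
  le_csSup (bddAbove_conjugate hΩ hΩ_bdd hc hconv p) (mem_image_of_mem _ hx)

theorem conjugate_gradient (hΩ : IsOpen Ω) (hΩ_bdd : Bornology.IsBounded Ω)
    (hc : ContDiffOn ℝ 2 φ Ω) (hconv : ConvexFunctionOn Ω φ) {x : EuclideanSpace ℝ (Fin n)}
    (hx : x ∈ Ω) : conjugate Ω φ (∇ φ x) = ⟪x, ∇ φ x⟫ - φ x := by
  refine le_antisymm (csSup_le ((nonempty_of_mem hx).image _) ?_)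
    (le_conjugate hΩ hΩ_bdd hc hconv hx _)
  rintro _ ⟨z, hz, rfl⟩
  have h := hconv.subgradient hΩ hx hz (hasGradientAt_of_contDiffOn hΩ hc hx)
  rw [real_inner_comm, inner_sub_left] at h
  simp only
  linarith

theorem continuous_conjugate (hΩ : IsOpen Ω) (hΩ_bdd : Bornology.IsBounded Ω)
    (hne : Ω.Nonempty) (hc : ContDiffOn ℝ 2 φ Ω) (hconv : ConvexFunctionOn Ω φ) :
    Continuous (conjugate Ω φ) := by
  obtain ⟨R, hR⟩ := hΩ_bdd.exists_norm_le
  have hR0 : 0 ≤ R := (norm_nonneg _).trans (hR _ hne.some_mem)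
  refine (LipschitzWith.of_le_add_mul R.toNNReal fun p q => ?_).continuous
  refine csSup_le (hne.image _) ?_
  rintro _ ⟨x, hx, rfl⟩
  have h1 := le_conjugate hΩ hΩ_bdd hc hconv hx q
  have h2 := (real_inner_le_norm x (p - q)).trans
    (mul_le_mul_of_nonneg_right (hR x hx) (norm_nonneg _))
  rw [inner_sub_right] at h2
  rw [Real.coe_toNNReal _ hR0, dist_eq_norm]
  simp only
  linarith

/-- Two functions with a common bounded selection of subgradients on a convex set differ there by
a constant. -/
theorem sub_le_sub_of_common_subgradient {K : Set (EuclideanSpace ℝ (Fin n))} (hK : Convex ℝ K)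
    {a b : EuclideanSpace ℝ (Fin n) → ℝ} {R : ℝ}
    (h : ∀ p ∈ K, ∃ x : EuclideanSpace ℝ (Fin n), ‖x‖ ≤ R ∧
      ∀ q, a p + ⟪x, q - p⟫ ≤ a q ∧ b p + ⟪x, q - p⟫ ≤ b q)
    {p q : EuclideanSpace ℝ (Fin n)} (hp : p ∈ K) (hq : q ∈ K) : a q - b q ≤ a p - b p := by
  -- Cut the segment into `N + 1` equal steps. On each, the subgradient inequality for `a` at the
  -- far end and for `b` at the near end bound the increment of `a - b`; the bounds telescope to
  -- `O(1/(N + 1))`.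
  have key : ∀ N : ℕ, (a q - b q) - (a p - b p) ≤ (2 * R * ‖q - p‖) * (1 / ((N : ℝ) + 1)) := by
    intro N
    have hN : (0 : ℝ) < (N : ℝ) + 1 := by positivity
    set s : ℝ := 1 / ((N : ℝ) + 1) with hs
    have hs0 : 0 < s := by positivity
    set P : ℕ → EuclideanSpace ℝ (Fin n) := fun i => p + ((i : ℝ) * s) • (q - p) with hP
    have hPK : ∀ i ≤ N + 1, P i ∈ K := by
      intro i hi
      refine hK.add_smul_sub_mem hp hq ⟨by positivity, ?_⟩
      rw [hs, mul_one_div, div_le_one hN]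
      exact_mod_cast hi
    have hstep : ∀ i, P (i + 1) - P i = s • (q - p) := by
      intro i
      simp only [hP]
      push_cast
      module
    have hx : ∀ i : ℕ, ∃ x : EuclideanSpace ℝ (Fin n), i ≤ N + 1 → ‖x‖ ≤ R ∧
        ∀ z, a (P i) + ⟪x, z - P i⟫ ≤ a z ∧ b (P i) + ⟪x, z - P i⟫ ≤ b z := by
      intro i
      by_cases hi : i ≤ N + 1
      · obtain ⟨x, hx⟩ := h _ (hPK i hi)
        exact ⟨x, fun _ => hx⟩
      · exact ⟨0, fun h => absurd h hi⟩
    choose x hx using hx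
    have hsum : ∑ i ∈ Finset.range (N + 1),
        ((a (P (i + 1)) - b (P (i + 1))) - (a (P i) - b (P i))) ≤
        ∑ i ∈ Finset.range (N + 1), (s * ⟪x (i + 1), q - p⟫ - s * ⟪x i, q - p⟫) := by
      refine Finset.sum_le_sum fun i hi => ?_
      have hi := Finset.mem_range.1 hi
      have h1 := ((hx (i + 1) (by omega)).2 (P i)).1
      have h2 := ((hx i (by omega)).2 (P (i + 1))).2
      rw [← neg_sub (P (i + 1)), inner_neg_right, hstep, inner_smul_right] at h1
      rw [hstep, inner_smul_right] at h2
      linarith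
    rw [Finset.sum_range_sub (fun i => a (P i) - b (P i)),
      Finset.sum_range_sub (fun i => s * ⟪x i, q - p⟫)] at hsum
    have hP0 : P 0 = p := by simp [hP]
    have hPN : P (N + 1) = q := by
      have : ((N + 1 : ℕ) : ℝ) * s = 1 := by
        rw [hs]
        push_cast
        field_simp
      simp only [hP, this]
      module
    rw [hP0, hPN, ← mul_sub, ← inner_sub_left] at hsum
    have h1 : ‖x (N + 1) - x 0‖ ≤ 2 * R := by
      linarith [norm_sub_le (x (N + 1)) (x 0), (hx (N + 1) le_rfl).1, (hx 0 (by omega)).1]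
    have h2 := (real_inner_le_norm (x (N + 1) - x 0) (q - p)).trans
      (mul_le_mul_of_nonneg_right h1 (norm_nonneg _))
    have h3 := mul_le_mul_of_nonneg_left h2 hs0.le
    linarith
  have hlim : Tendsto (fun N : ℕ => (2 * R * ‖q - p‖) * (1 / ((N : ℝ) + 1))) atTop (𝓝 0) := by
    simpa using tendsto_one_div_add_atTop_nhds_zero_nat.const_mul (2 * R * ‖q - p‖)
  linarith [ge_of_tendsto' hlim key]

theorem integrable_densityMeasure_of_continuous (hΛ_bdd : Bornology.IsBounded Λ)
    (hΛ : MeasurableSet Λ) (hg : BoundedAwayFromZeroAndInfinityOn Λ g)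
    {w : EuclideanSpace ℝ (Fin n) → ℝ} (hw : Continuous w) :
    Integrable w (densityMeasure Λ g) := by
  have : IsFiniteMeasure (densityMeasure Λ g) := ⟨by
    rw [densityMeasure_apply MeasurableSet.univ, univ_inter]
    exact (lintegral_ofReal_ne_top hΛ_bdd hg).lt_top⟩
  obtain ⟨C, hC⟩ := hΛ_bdd.isCompact_closure.exists_bound_of_continuousOn hw.continuousOn
  refine Integrable.of_bound hw.aestronglyMeasurable C
    (densityMeasure_absolutelyContinuous.ae_le ?_)
  filter_upwards [ae_restrict_mem hΛ] with x hx using hC x (subset_closure hx)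

/-- With `w = φ* - ψ*`, the function `w(∇ψ) - w(∇φ)` has integral zero because both gradients push
`f dx` to the same measure. It is the sum of the two Fenchel–Young gaps of `(φ, ∇ψ)` and `(ψ, ∇φ)`,
so both gaps vanish. -/
theorem IsBrenierPotential.gradient_eq (hΩ : IsOpen Ω) (hΩ_bdd : Bornology.IsBounded Ω)
    (hΛ : IsOpen Λ) (hΛ_bdd : Bornology.IsBounded Λ) (hf_cont : ContinuousOn f Ω)
    (hf : BoundedAwayFromZeroAndInfinityOn Ω f) (hg : BoundedAwayFromZeroAndInfinityOn Λ g)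
    (hφ : IsBrenierPotential Ω Λ f g φ) (hψ : IsBrenierPotential Ω Λ f g ψ) :
    ∀ x ∈ Ω, ∇ φ x = ∇ ψ x := by
  intro x₀ hx₀
  set w := fun p => conjugate Ω φ p - conjugate Ω ψ p with hw
  have hwc : Continuous w :=
    (continuous_conjugate hΩ hΩ_bdd ⟨x₀, hx₀⟩ hφ.contDiffOn hφ.convex).sub
      (continuous_conjugate hΩ hΩ_bdd ⟨x₀, hx₀⟩ hψ.contDiffOn hψ.convex)
  have hmφ : AEMeasurable (∇ φ) (densityMeasure Ω f) :=
    (aemeasurable_gradient hΩ hφ.contDiffOn).mono_ac densityMeasure_absolutelyContinuous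
  have hmψ : AEMeasurable (∇ ψ) (densityMeasure Ω f) :=
    (aemeasurable_gradient hΩ hψ.contDiffOn).mono_ac densityMeasure_absolutelyContinuous
  have hint := integrable_densityMeasure_of_continuous hΛ_bdd hΛ.measurableSet hg hwc
  have hiφ : Integrable (fun x => w (∇ φ x)) (densityMeasure Ω f) :=
    (integrable_map_measure hwc.aestronglyMeasurable hmφ).1 (hφ.map_gradient ▸ hint)
  have hiψ : Integrable (fun x => w (∇ ψ x)) (densityMeasure Ω f) :=
    (integrable_map_measure hwc.aestronglyMeasurable hmψ).1 (hψ.map_gradient ▸ hint)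
  have hzero : ∫ x, (w (∇ ψ x) - w (∇ φ x)) ∂densityMeasure Ω f = 0 := by
    rw [integral_sub hiψ hiφ, ← integral_map hmφ hwc.aestronglyMeasurable,
      ← integral_map hmψ hwc.aestronglyMeasurable, hφ.map_gradient, hψ.map_gradient, sub_self]
  have hφ1 := fun x hx p => le_conjugate (x := x) hΩ hΩ_bdd hφ.contDiffOn hφ.convex hx p
  have hψ1 := fun x hx p => le_conjugate (x := x) hΩ hΩ_bdd hψ.contDiffOn hψ.convex hx p
  have hφ2 := fun x hx => conjugate_gradient (x := x) hΩ hΩ_bdd hφ.contDiffOn hφ.convex hx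
  have hψ2 := fun x hx => conjugate_gradient (x := x) hΩ hΩ_bdd hψ.contDiffOn hψ.convex hx
  have hnonneg : 0 ≤ᵐ[densityMeasure Ω f] fun x => w (∇ ψ x) - w (∇ φ x) := by
    refine densityMeasure_absolutelyContinuous.ae_le ?_
    filter_upwards [ae_restrict_mem hΩ.measurableSet] with x hx
    have h1 := hφ1 x hx (∇ ψ x)
    have h2 := hψ1 x hx (∇ φ x)
    simp only [hw, hφ2 x hx, hψ2 x hx, Pi.zero_apply]
    linarith
  have hac : volume.restrict Ω ≪ densityMeasure Ω f := by
    obtain ⟨m, M, hm, hfm⟩ := hf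
    refine withDensity_absolutelyContinuous'
      (hf_cont.aemeasurable hΩ.measurableSet).ennreal_ofReal ?_
    filter_upwards [ae_restrict_mem hΩ.measurableSet] with x hx
    exact (ENNReal.ofReal_pos.2 (hm.trans_le (hfm x hx).1)).ne'
  have hae := hac.ae_le ((integral_eq_zero_iff_of_nonneg_ae hnonneg (hiψ.sub hiφ)).1 hzero)
  have hall : w (∇ ψ x₀) - w (∇ φ x₀) = 0 :=
    eqOn_zero_of_ae (u := fun x => w (∇ ψ x) - w (∇ φ x)) hΩ
      ((hwc.comp_continuousOn (contDiffOn_gradient hΩ hψ.contDiffOn).continuousOn).sub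
        (hwc.comp_continuousOn (contDiffOn_gradient hΩ hφ.contDiffOn).continuousOn)) hae x₀ hx₀
  -- A zero gap for `φ` says that `∇ψ x₀` is a subgradient of `φ` at `x₀`.
  refine HasGradientAt.eq_of_subgradient hΩ hx₀
    (hasGradientAt_of_contDiffOn hΩ hφ.contDiffOn hx₀) fun z hz => ?_
  have h1 := hφ1 z hz (∇ ψ x₀)
  have h2 := hψ1 x₀ hx₀ (∇ φ x₀)
  simp only [hw, hφ2 x₀ hx₀, hψ2 x₀ hx₀] at hall
  rw [real_inner_comm, inner_sub_left]
  linarith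

theorem IsBrenierPotential.eq_add_const (hΩ : IsOpen Ω) (hΩ_bdd : Bornology.IsBounded Ω)
    (hΛ : IsOpen Λ) (hΛ_bdd : Bornology.IsBounded Λ) (hΛ_convex : Convex ℝ Λ)
    (hf_cont : ContinuousOn f Ω) (hg_cont : ContinuousOn g Λ)
    (hf : BoundedAwayFromZeroAndInfinityOn Ω f) (hg : BoundedAwayFromZeroAndInfinityOn Λ g)
    (hφ : IsBrenierPotential Ω Λ f g φ) (hψ : IsBrenierPotential Ω Λ f g ψ)
    (hmaps : MapsTo (∇ φ) Ω Λ) : ∃ c : ℝ, ∀ x ∈ Ω, ψ x = φ x + c := by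
  rcases Ω.eq_empty_or_nonempty with rfl | ⟨x₀, hx₀⟩
  · exact ⟨0, fun x hx => hx.elim⟩
  obtain ⟨R, hR⟩ := hΩ_bdd.exists_norm_le
  have hgrad := hφ.gradient_eq hΩ hΩ_bdd hΛ hΛ_bdd hf_cont hf hg hψ
  have hφ1 := fun x hx p => le_conjugate (x := x) hΩ hΩ_bdd hφ.contDiffOn hφ.convex hx p
  have hψ1 := fun x hx p => le_conjugate (x := x) hΩ hΩ_bdd hψ.contDiffOn hψ.convex hx p
  have hφ2 := fun x hx => conjugate_gradient (x := x) hΩ hΩ_bdd hφ.contDiffOn hφ.convex hx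
  have hψ2 := fun x hx => conjugate_gradient (x := x) hΩ hΩ_bdd hψ.contDiffOn hψ.convex hx
  have hcφ := continuous_conjugate hΩ hΩ_bdd ⟨x₀, hx₀⟩ hφ.contDiffOn hφ.convex
  have hcψ := continuous_conjugate hΩ hΩ_bdd ⟨x₀, hx₀⟩ hψ.contDiffOn hψ.convex
  -- Approximate `p` by gradients at points of `Ω` and pass to a limit of these points. Since `∇φ =
  -- ∇ψ`, the limit is a subgradient of both conjugates.
  have hsub : ∀ p ∈ Λ, ∃ x : EuclideanSpace ℝ (Fin n), ‖x‖ ≤ R ∧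
      ∀ q, conjugate Ω φ p + ⟪x, q - p⟫ ≤ conjugate Ω φ q ∧
        conjugate Ω ψ p + ⟪x, q - p⟫ ≤ conjugate Ω ψ q := by
    intro p hp
    obtain ⟨u, hu, hup⟩ := mem_closure_iff_seq_limit.1
      (hφ.subset_closure_image hΩ hΛ hg_cont hg hp)
    choose x hxΩ hxu using hu
    obtain ⟨y, -, k, hk, hy⟩ := hΩ_bdd.isCompact_closure.tendsto_subseq
      (fun i => subset_closure (hxΩ i))
    have hup' := hup.comp hk.tendsto_atTop
    refine ⟨y, le_of_tendsto' hy.norm fun i => hR _ (hxΩ _), fun q => ⟨?_, ?_⟩⟩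
    · refine le_of_tendsto' (((hcφ.tendsto p).comp hup').add
        (hy.inner (tendsto_const_nhds.sub hup'))) fun i => ?_
      have h1 := hφ1 _ (hxΩ (k i)) q
      have h2 := hφ2 _ (hxΩ (k i))
      rw [hxu] at h2
      simp only [Function.comp_apply, inner_sub_right, h2]
      linarith
    · refine le_of_tendsto' (((hcψ.tendsto p).comp hup').add
        (hy.inner (tendsto_const_nhds.sub hup'))) fun i => ?_
      have h1 := hψ1 _ (hxΩ (k i)) q
      have h2 := hψ2 _ (hxΩ (k i))
      rw [← hgrad _ (hxΩ (k i)), hxu] at h2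
      simp only [Function.comp_apply, inner_sub_right, h2]
      linarith
  refine ⟨conjugate Ω φ (∇ φ x₀) - conjugate Ω ψ (∇ φ x₀), fun x hx => ?_⟩
  have h1 := sub_le_sub_of_common_subgradient hΛ_convex hsub (hmaps hx₀) (hmaps hx)
  have h2 := sub_le_sub_of_common_subgradient hΛ_convex hsub (hmaps hx) (hmaps hx₀)
  have h3 := hφ2 x hx
  have h4 := hψ2 x hx
  rw [← hgrad x hx] at h4
  linarith

end Conjugate

/-! ### Zero sets of the deficits and the minimization argument -/

section Objectives

variable {n : ℕ} {Ω Λ : Set (EuclideanSpace ℝ (Fin n))} {f g : EuclideanSpace ℝ (Fin n) → ℝ}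
  {φ ψ : EuclideanSpace ℝ (Fin n) → ℝ}

theorem logDeficit_eq_zero_iff {x : EuclideanSpace ℝ (Fin n)} (hd : 0 ≤ hessianDet ψ x)
    (hf : 0 < f x) (hg : 0 < g (∇ ψ x)) :
    logDeficit f g ψ x = 0 ↔ f x ≤ hessianDet ψ x * g (∇ ψ x) := by
  rw [logDeficit, EReal.toENNReal_eq_zero_iff, max_le_iff, ENNReal.log_ofReal]
  rcases hd.eq_or_lt with h0 | h0
  -- At zero determinant the logarithm is `-∞`, the deficit is `+∞`, and the inequality fails
  -- because `f x > 0`.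
  · simp [← h0, hf]
  · rw [if_neg h0.not_ge]
    norm_cast
    rw [← Real.log_le_log_iff hf (mul_pos h0 hg), Real.log_mul h0.ne' hg.ne']
    constructor
    · intro h
      linarith [h.2]
    · intro h
      exact ⟨le_rfl, by linarith⟩

theorem rootDeficit_eq_zero_iff (hn : 1 ≤ n) {x : EuclideanSpace ℝ (Fin n)}
    (hd : 0 ≤ hessianDet ψ x) (hf : 0 < f x) (hg : 0 < g (∇ ψ x)) :
    rootDeficit f g ψ x = 0 ↔ f x ≤ hessianDet ψ x * g (∇ ψ x) := by
  -- For `n = 0` the exponent would be `0` and the deficit would vanish identically.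
  have hn' : 0 < 1 / (n : ℝ) := by positivity
  rw [← div_le_iff₀ hg, ← Real.rpow_le_rpow_iff (div_pos hf hg).le hd hn', rootDeficit,
    ENNReal.ofReal_eq_zero, max_le_iff]
  constructor
  · intro h
    linarith [h.2]
  · intro h
    exact ⟨le_rfl, by linarith⟩

theorem extendPenalty_eq_zero_iff {h : ℝ → ℝ} (hmono : StrictMonoOn h (Ici 0)) (h0 : h 0 = 0)
    {t : ℝ≥0∞} : extendPenalty h t = 0 ↔ t = 0 := by
  rw [extendPenalty]
  split_ifs with ht
  · simp [ht]
  · rw [ENNReal.ofReal_eq_zero, ← h0,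
      hmono.le_iff_le (mem_Ici.2 ENNReal.toReal_nonneg) (mem_Ici.2 le_rfl),
      ENNReal.toReal_nonneg.ge_iff_eq', ENNReal.toReal_eq_zero_iff, or_iff_left ht]

/-- Monotonicity supplies the measurability of the penalized integrand. -/
theorem monotone_extendPenalty {h : ℝ → ℝ} (hmono : StrictMonoOn h (Ici 0)) :
    Monotone (extendPenalty h) := by
  intro s t hst
  by_cases ht : t = ∞
  · simp [extendPenalty, ht]
  · have hs : s ≠ ∞ := (hst.trans_lt (lt_top_iff_ne_top.2 ht)).ne
    simp only [extendPenalty, if_neg ht, if_neg hs]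
    exact ENNReal.ofReal_le_ofReal (hmono.monotoneOn (mem_Ici.2 ENNReal.toReal_nonneg)
      (mem_Ici.2 ENNReal.toReal_nonneg) (ENNReal.toReal_mono ht hst))

theorem continuousOn_comp_gradient (hΩ : IsOpen Ω) (hg_cont : ContinuousOn g Λ)
    (hψ : ψ ∈ competitors Ω Λ) : ContinuousOn (fun x => g (∇ ψ x)) Ω :=
  hg_cont.comp (contDiffOn_gradient hΩ hψ.1).continuousOn hψ.2.2

theorem aemeasurable_logDeficit (hΩ : IsOpen Ω) (hf_cont : ContinuousOn f Ω)
    (hg_cont : ContinuousOn g Λ) (hψ : ψ ∈ competitors Ω Λ) :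
    AEMeasurable (logDeficit f g ψ) (volume.restrict Ω) := by
  have hf := hf_cont.aemeasurable (μ := volume) hΩ.measurableSet
  have hd := (continuousOn_hessianDet hΩ hψ.1).aemeasurable (μ := volume) hΩ.measurableSet
  have hg := (continuousOn_comp_gradient hΩ hg_cont hψ).aemeasurable (μ := volume)
    hΩ.measurableSet
  have h1 := (ENNReal.measurable_log.comp_aemeasurable hd.ennreal_ofReal).neg
  have h2 := (Real.measurable_log.comp_aemeasurable hg).coe_real_ereal
  have h3 := (Real.measurable_log.comp_aemeasurable hf).coe_real_ereal
  exact (aemeasurable_const.max ((h1.sub h2).add h3)).ereal_toENNReal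

theorem aemeasurable_rootDeficit (hΩ : IsOpen Ω) (hf_cont : ContinuousOn f Ω)
    (hg_cont : ContinuousOn g Λ) (hψ : ψ ∈ competitors Ω Λ) :
    AEMeasurable (rootDeficit f g ψ) (volume.restrict Ω) := by
  have hf := hf_cont.aemeasurable (μ := volume) hΩ.measurableSet
  have hd := (continuousOn_hessianDet hΩ hψ.1).aemeasurable (μ := volume) hΩ.measurableSet
  have hg := (continuousOn_comp_gradient hΩ hg_cont hψ).aemeasurable (μ := volume)
    hΩ.measurableSet
  exact (aemeasurable_const.max
    ((hd.pow_const _).neg.add ((hf.div hg).pow_const _))).ennreal_ofReal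

/-- Only the zero set of the integrand matters, so one argument serves all three functionals. -/
theorem isUniqueMinimizerUpToConst_lintegral
    (hΩ : IsOpen Ω) (hΩ_bdd : Bornology.IsBounded Ω) (hΛ : IsOpen Λ)
    (hΛ_bdd : Bornology.IsBounded Λ) (hΛ_convex : Convex ℝ Λ)
    (hf_cont : ContinuousOn f Ω) (hg_cont : ContinuousOn g (closure Λ))
    (hf : BoundedAwayFromZeroAndInfinityOn Ω f) (hg : BoundedAwayFromZeroAndInfinityOn Λ g)
    (h_mass : ∫⁻ x in Ω, ENNReal.ofReal (f x) = ∫⁻ y in Λ, ENNReal.ofReal (g y))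
    (hφ : IsBrenierPotential Ω Λ f g φ)
    {k : (EuclideanSpace ℝ (Fin n) → ℝ) → EuclideanSpace ℝ (Fin n) → ℝ≥0∞}
    (hk_meas : ∀ ψ ∈ competitors Ω Λ, AEMeasurable (k ψ) (volume.restrict Ω))
    (hk : ∀ ψ, ∀ x ∈ Ω, 0 ≤ hessianDet ψ x → 0 < f x → 0 < g (∇ ψ x) →
      (k ψ x = 0 ↔ f x ≤ hessianDet ψ x * g (∇ ψ x))) :
    IsUniqueMinimizerUpToConst Ω (competitors Ω Λ) (fun ψ => ∫⁻ x in Ω, k ψ x) φ := by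
  obtain ⟨hmaps, heq⟩ := hφ.mongeAmpere hΩ hΩ_bdd hΛ hΛ_convex hf_cont hg_cont hf hg
  have hgΛ := hg_cont.mono subset_closure
  have hk' : ∀ ψ ∈ competitors Ω Λ, ∀ x ∈ Ω,
      (k ψ x = 0 ↔ f x ≤ hessianDet ψ x * g (∇ ψ x)) := by
    obtain ⟨m, M, hm, hfm⟩ := hf
    obtain ⟨m', M', hm', hgm⟩ := hg
    exact fun ψ hψ x hx => hk ψ x hx (hψ.2.1.hessianDet_nonneg hΩ hψ.1 hx)
      (hm.trans_le (hfm x hx).1) (hm'.trans_le (hgm _ (hψ.2.2 hx)).1)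
  have hφJ : φ ∈ competitors Ω Λ := ⟨hφ.contDiffOn, hφ.convex, hmaps⟩
  have hφ0 : ∫⁻ x in Ω, k φ x = 0 := by
    rw [setLIntegral_congr_fun (g := fun _ => 0) hΩ.measurableSet
      fun x hx => (hk' φ hφJ x hx).2 (heq x hx).ge, lintegral_zero]
  refine ⟨hφJ, isMinOn_iff.2 fun ψ _ => by simp [hφ0], fun ψ hψ hmin => ?_⟩
  have hψ0 : ∫⁻ x in Ω, k ψ x = 0 := le_antisymm (hφ0 ▸ isMinOn_iff.1 hmin φ hφJ) zero_le
  have hae := (lintegral_eq_zero_iff' (hk_meas ψ hψ)).1 hψ0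
  have hdiff : ContinuousOn (fun x => f x - hessianDet ψ x * g (∇ ψ x)) Ω := hf_cont.sub
    ((continuousOn_hessianDet hΩ hψ.1).mul (continuousOn_comp_gradient hΩ hgΛ hψ))
  have hle : ∀ x ∈ Ω, f x ≤ hessianDet ψ x * g (∇ ψ x) := by
    intro x hx
    -- The positive part turns the inequality into the vanishing of a continuous function, which
    -- passes from almost everywhere to everywhere.
    have h := eqOn_zero_of_ae (u := fun x => max 0 (f x - hessianDet ψ x * g (∇ ψ x))) hΩ
      (continuousOn_const.sup hdiff) (by
        filter_upwards [hae, ae_restrict_mem hΩ.measurableSet] with x hx hxΩ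
        exact max_eq_left (sub_nonpos.2 ((hk' ψ hψ x hxΩ).1 hx))) x hx
    exact sub_nonpos.1 (max_eq_left_iff.1 h)
  exact hφ.eq_add_const hΩ hΩ_bdd hΛ hΛ_bdd hΛ_convex hf_cont hgΛ hf hg
    (isBrenierPotential_of_le hΩ hΩ_bdd hf h_mass hψ hle) hmaps

theorem ofReal_integral_eq_setLIntegral (hΩ : IsOpen Ω) (hΩ_bdd : Bornology.IsBounded Ω)
    (hf_cont : ContinuousOn f Ω) (hf : BoundedAwayFromZeroAndInfinityOn Ω f) :
    ENNReal.ofReal (∫ x in Ω, f x) = ∫⁻ x in Ω, ENNReal.ofReal (f x) := by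
  obtain ⟨m, M, hm, hfm⟩ := hf
  have : IsFiniteMeasure (volume.restrict Ω) :=
    isFiniteMeasure_restrict.2 hΩ_bdd.measure_lt_top.ne
  refine ofReal_integral_eq_lintegral_ofReal (Integrable.of_bound
    (hf_cont.aestronglyMeasurable hΩ.measurableSet) M ?_) ?_
  · filter_upwards [ae_restrict_mem hΩ.measurableSet] with x hx
    rw [Real.norm_of_nonneg (hm.le.trans (hfm x hx).1)]
    exact (hfm x hx).2
  · filter_upwards [ae_restrict_mem hΩ.measurableSet] with x hx
    exact hm.le.trans (hfm x hx).1

end Objectives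

end MongeAmpere

/-! ### The three functionals -/

theorem mainTheorem3 {n : ℕ} (hn : 1 ≤ n)
    (Ω Λ : Set (EuclideanSpace ℝ (Fin n)))
    (hΩ_open : IsOpen Ω) (hΩ_bdd : Bornology.IsBounded Ω)
    (hΛ_open : IsOpen Λ) (hΛ_bdd : Bornology.IsBounded Λ) (hΛ_convex : Convex ℝ Λ)
    (f g : EuclideanSpace ℝ (Fin n) → ℝ)
    (hf_cont : ContinuousOn f (closure Ω)) (hg_cont : ContinuousOn g (closure Λ))
    (hf_bdd : MongeAmpere.BoundedAwayFromZeroAndInfinityOn Ω f)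
    (hg_bdd : MongeAmpere.BoundedAwayFromZeroAndInfinityOn Λ g)
    (h_mass : ∫ x in Ω, f x = ∫ y in Λ, g y)
    (φ : EuclideanSpace ℝ (Fin n) → ℝ)
    (hφ : MongeAmpere.IsBrenierPotential Ω Λ f g φ) :
    MongeAmpere.IsUniqueMinimizerUpToConst Ω (MongeAmpere.competitors Ω Λ)
        (MongeAmpere.logObjective Ω f g) φ ∧
      MongeAmpere.IsUniqueMinimizerUpToConst Ω (MongeAmpere.competitors Ω Λ)
        (MongeAmpere.rootObjective Ω f g) φ ∧
      ∀ (h : ℝ → ℝ) (ρ : EuclideanSpace ℝ (Fin n) → ℝ),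
        ConvexOn ℝ (Ici 0) h → StrictMonoOn h (Ici 0) → h 0 = 0 →
        AEMeasurable ρ (volume.restrict Ω) →
        MongeAmpere.BoundedAwayFromZeroAndInfinityOn Ω ρ →
        MongeAmpere.IsUniqueMinimizerUpToConst Ω (MongeAmpere.competitors Ω Λ)
          (MongeAmpere.penalizedObjective Ω f g h ρ) φ := by
  have hfΩ := hf_cont.mono subset_closure
  have hgΛ := hg_cont.mono subset_closure
  have h_mass' : ∫⁻ x in Ω, ENNReal.ofReal (f x) = ∫⁻ y in Λ, ENNReal.ofReal (g y) := by
    rw [← MongeAmpere.ofReal_integral_eq_setLIntegral hΩ_open hΩ_bdd hfΩ hf_bdd, h_mass,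
      MongeAmpere.ofReal_integral_eq_setLIntegral hΛ_open hΛ_bdd hgΛ hg_bdd]
  refine ⟨?_, ?_, fun h ρ _ hmono h0 hρ hρ_bdd => ?_⟩
  · exact MongeAmpere.isUniqueMinimizerUpToConst_lintegral hΩ_open hΩ_bdd hΛ_open hΛ_bdd
      hΛ_convex hfΩ hg_cont hf_bdd hg_bdd h_mass' hφ
      (fun ψ hψ => MongeAmpere.aemeasurable_logDeficit hΩ_open hfΩ hgΛ hψ)
      fun ψ x _ hd hfx hgx => MongeAmpere.logDeficit_eq_zero_iff hd hfx hgx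
  · exact MongeAmpere.isUniqueMinimizerUpToConst_lintegral hΩ_open hΩ_bdd hΛ_open hΛ_bdd
      hΛ_convex hfΩ hg_cont hf_bdd hg_bdd h_mass' hφ
      (fun ψ hψ => MongeAmpere.aemeasurable_rootDeficit hΩ_open hfΩ hgΛ hψ)
      fun ψ x _ hd hfx hgx => MongeAmpere.rootDeficit_eq_zero_iff hn hd hfx hgx
  · obtain ⟨m, M, hm, hρm⟩ := hρ_bdd
    refine MongeAmpere.isUniqueMinimizerUpToConst_lintegral hΩ_open hΩ_bdd hΛ_open hΛ_bdd
      hΛ_convex hfΩ hg_cont hf_bdd hg_bdd h_mass' hφ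
      (fun ψ hψ => ((MongeAmpere.monotone_extendPenalty hmono).measurable.comp_aemeasurable
        (MongeAmpere.aemeasurable_logDeficit hΩ_open hfΩ hgΛ hψ)).mul hρ.ennreal_ofReal)
      fun ψ x hx hd hfx hgx => ?_
    rw [mul_eq_zero, or_iff_left (ENNReal.ofReal_pos.2 (hm.trans_le (hρm x hx).1)).ne',
      MongeAmpere.extendPenalty_eq_zero_iff hmono h0,
      MongeAmpere.logDeficit_eq_zero_iff hd hfx hgx]
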